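/- **Setting.** Let $\mathcal H_1,\mathcal H_2$ be complex Hilbert spaces, let $A_1,A_2$ be (possibly unbounded) self-adjoint operators in $\mathcal H_1,\mathcal H_2$ with $\operatorname{dist}(\sigma(A_1),\sigma(A_2))>0$, and let $B_{12}:\mathcal H_2\to\mathcal H_1$ be a bounded operator with finite Hilbert–Schmidt norm, $B_{21}=B_{12}^*$. Let $$\mathbf H=\begin{pmatrix}A_1&B_{12}\\B_{21}&A_2\end{pmatrix},\qquad \mathcal D(\mathbf H)=\mathcal D(A_1)\oplus\mathcal D(A_2),$$ in $\mathcal H_1\oplus\mathcal H_2$. Let $Q_{21}:\mathcal H_1\to\mathcal H_2$ be a bounded operator, $Q_{12}=-Q_{21}^*$, and put $H_1=A_1+B_{12}Q_{21}$ on $\mathcal D(A_1)$ and $H_2=A_2+B_{21}Q_{12}$ on $\mathcal D(A_2)$. Suppose that: * $Q_{21}$ solves the basic equation $Q_{21}=\int_{\sigma(A_2)}E_2(d\mu)\,B_{21}\,(A_1+B_{12}Q_{21}-\mu)^{-1}$, where $E_2$ is the spectral measure of $A_2$ and the integral is the operator-norm limit of the integral sums $\sum_k E_2(\Delta_k)B_{21}T_k$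 of piecewise constant operator functions approximating $\mu\mapsto(A_1+B_{12}Q_{21}-\mu)^{-1}$ in $L_\infty(\sigma(A_2))$; * $Q_{21}$ satisfies its symmetric form: $Q_{21}\mathcal D(A_1)\subset\mathcal D(A_2)$ and $Q_{21}A_1-A_2Q_{21}+Q_{21}B_{12}Q_{21}=B_{21}$ on $\mathcal D(A_1)$; * there are $C_{12},C_{21}>0$ such that $(H_1-\mu)^{-1}$ exists with $\|(H_1-\mu)^{-1}\|\le \frac{C_{12}}{1+|\mu|}$ for all $\mu\in\sigma(A_2)$, and $(H_2-\mu)^{-1}$ exists with $\|(H_2-\mu)^{-1}\|\le\frac{C_{21}}{1+|\mu|}$ for all $\mu\in\sigma(A_1)$. **Theorem.** Let $\{\alpha,\beta\}=\{1,2\}$ and let $U=\{u_1,u_2\}$ be an eigenvector of $\mathbf H$, $\mathbf HU=zU$, such that $u_\alpha$ is an eigenvector of $H_\alpha$ with the same eigenvalue, $u_\alpha\ne0$, $H_\alpha u_\alpha=zu_\alpha$. Then $u_\beta$ is not an eigenvector of $H_\beta$ corresponding to the eigenvalue $z$ (either $z$ is not an eigenvalue of $H_\beta$ at all, or it is one but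 $u_\beta$ is not an eigenvector for it). **Corollary.** For $\alpha=1,2$ let $\mathcal U^d_\alpha$ be the set of the eigenvectors $U=\{u_1,u_2\}$ of $\mathbf H$, $\mathbf HU=zU$, for which $u_\alpha$ is an eigenvector of $H_\alpha$ corresponding to the same eigenvalue $z$. Then $\mathcal U^d_1\cap\mathcal U^d_2=\emptyset$. -/

import Mathlib

noncomputable section

namespace TwoChannel

variable {E F : Type*}
  [NormedAddCommGroup E] [InnerProductSpace ℂ E] [CompleteSpace E]
  [NormedAddCommGroup F] [InnerProductSpace ℂ F] [CompleteSpace F]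

/-! ### Eigenvectors, resolvents and spectra of partially defined operators -/

/-- `u` is an eigenvector of the operator `T` corresponding to the eigenvalue `z`. -/
def IsEigenvector (T : E →ₗ.[ℂ] E) (z : ℂ) (u : E) : Prop :=
  u ≠ 0 ∧ ∃ h : u ∈ T.domain, T ⟨u, h⟩ = z • u

/-- `R` is a bounded, everywhere defined two-sided inverse of `T - z`. -/
def IsResolventAt (T : E →ₗ.[ℂ] E) (z : ℂ) (R : E →L[ℂ] E) : Prop :=
  (∀ f : E, ∃ h : R f ∈ T.domain, T ⟨R f, h⟩ - z • R f = f) ∧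
    ∀ f : T.domain, R (T f - z • (f : E)) = f

/-- The resolvent set: the points `z` for which `(T - z)⁻¹` exists as a bounded operator on the
whole space. -/
def resolventSet (T : E →ₗ.[ℂ] E) : Set ℂ :=
  {z | ∃ R : E →L[ℂ] E, IsResolventAt T z R}

/-- The spectrum, the complement of the resolvent set. -/
def spectrum (T : E →ₗ.[ℂ] E) : Set ℂ :=
  (resolventSet T)ᶜ

open Classical in
/-- The resolvent `(T - z)⁻¹` (by convention `0` when `z` lies in the spectrum of `T`). -/
def resolvent (T : E →ₗ.[ℂ] E) (z : ℂ) : E →L[ℂ] E :=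
  if h : ∃ R : E →L[ℂ] E, IsResolventAt T z R then h.choose else 0

/-- The real points of the spectrum (for a self-adjoint operator, the whole spectrum). -/
def realSpectrum (T : E →ₗ.[ℂ] E) : Set ℝ :=
  {x | (x : ℂ) ∈ spectrum T}

/-- The Hilbert-Schmidt norm of `B` is finite. -/
def IsHilbertSchmidt (B : E →L[ℂ] F) : Prop :=
  ∃ (w : Set E) (b : HilbertBasis w ℂ E), Summable fun i => ‖B (b i)‖ ^ 2

/-! ### Spectral measures and integrals of operator-valued functions over them -/

/-- A projection-valued measure on the Borel subsets of the real line: its values are orthogonal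
projections, it is multiplicative on intersections, countably additive in the strong operator
topology, and normalized. (Its values on non-measurable sets are irrelevant.) -/
structure ProjectionMeasure (F : Type*) [NormedAddCommGroup F] [InnerProductSpace ℂ F]
    [CompleteSpace F] where
  proj : Set ℝ → F →L[ℂ] F
  isStarProjection : ∀ s, MeasurableSet s → IsStarProjection (proj s)
  proj_univ : proj Set.univ = 1
  proj_inter : ∀ s t, MeasurableSet s → MeasurableSet t → proj (s ∩ t) = proj s * proj t
  hasSum_iUnion : ∀ s : ℕ → Set ℝ, (∀ n, MeasurableSet (s n)) →
    Pairwise (fun m n => Disjoint (s m) (s n)) →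
      ∀ f : F, HasSum (fun n => proj (s n) f) (proj (⋃ n, s n) f)

namespace ProjectionMeasure

variable (P : ProjectionMeasure F)

theorem proj_empty : P.proj ∅ = 0 := by
  ext f
  have h := (P.hasSum_iUnion (fun _ => ∅) (fun _ => MeasurableSet.empty)
    (fun _ _ _ => by simp) f).summable
  simpa using tendsto_nhds_unique h.tendsto_atTop_zero tendsto_const_nhds |>.symm

theorem inner_proj {s : Set ℝ} (hs : MeasurableSet s) (f : F) :
    inner ℂ f (P.proj s f) = ((‖P.proj s f‖ ^ 2 : ℝ) : ℂ) := by
  have h := P.isStarProjection s hs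
  have h1 : P.proj s (P.proj s f) = P.proj s f :=
    congrArg (fun T : F →L[ℂ] F => T f) h.isIdempotentElem
  have h2 : ContinuousLinearMap.adjoint (P.proj s) = P.proj s := h.isSelfAdjoint
  calc inner ℂ f (P.proj s f) = inner ℂ f (P.proj s (P.proj s f)) := by rw [h1]
    _ = inner ℂ (P.proj s f) (P.proj s f) := by
        rw [← ContinuousLinearMap.adjoint_inner_left, h2]
    _ = _ := by rw [inner_self_eq_norm_sq_to_K]; simp

theorem hasSum_sq {s : ℕ → Set ℝ} (hs : ∀ n, MeasurableSet (s n))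
    (hd : Pairwise (fun m n => Disjoint (s m) (s n))) (f : F) :
    HasSum (fun n => ‖P.proj (s n) f‖ ^ 2) (‖P.proj (⋃ n, s n) f‖ ^ 2) := by
  have h := (P.hasSum_iUnion s hs hd f).mapL (innerSL ℂ f)
  simp only [innerSL_apply_apply] at h
  rw [P.inner_proj (MeasurableSet.iUnion hs)] at h
  simp only [fun n => P.inner_proj (hs n) f] at h
  exact_mod_cast h

/-- The scalar measure `s ↦ ‖P(s) f‖² = ⟨P(s) f, f⟩`. -/
def scalarMeasure (f : F) : MeasureTheory.Measure ℝ :=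
  MeasureTheory.Measure.ofMeasurable (fun s _ => ENNReal.ofReal (‖P.proj s f‖ ^ 2))
    (by simp [P.proj_empty])
    (fun s hs hd => by
      have h := P.hasSum_sq hs hd f
      rw [← h.tsum_eq, ENNReal.ofReal_tsum_of_nonneg (fun _ => by positivity) h.summable])

/-- `P` is the spectral measure of the operator `A`, that is, `A = ∫ x P(dx)`. -/
def IsSpectralMeasureOf (A : F →ₗ.[ℂ] F) : Prop :=
  (∀ f : F, f ∈ A.domain ↔ ∫⁻ x, ENNReal.ofReal (x ^ 2) ∂(P.scalarMeasure f) < ⊤) ∧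
    ∀ f : A.domain, inner ℂ (f : F) (A f) = ∫ x, (x : ℂ) ∂(P.scalarMeasure (f : F))

/-- The finite integral sum `∑ P(Δₖ) B Tₖ`, where the sets `Δₖ` form a partition of `σ` and `Tₖ` is
the value of the piecewise constant operator-valued function `S` on `Δₖ`. -/
def integralSum (σ : Set ℝ) (B : E →L[ℂ] F) (S : MeasureTheory.SimpleFunc ℝ (E →L[ℂ] E)) :
    E →L[ℂ] F :=
  ∑ T ∈ S.range, P.proj (σ ∩ S ⁻¹' {T}) ∘L B ∘L T

/-- `I = ∫_σ P(dx) B T(x)`: the operator `I` is the limit, in the operator norm, of the integral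
sums of piecewise constant functions which approximate `T` in `L_∞(σ)` (uniformly on `σ` outside a
set of zero `P`-measure). -/
def HasIntegral (σ : Set ℝ) (B : E →L[ℂ] F) (T : ℝ → E →L[ℂ] E) (I : E →L[ℂ] F) : Prop :=
  ∃ S : ℕ → MeasureTheory.SimpleFunc ℝ (E →L[ℂ] E),
    (∃ N : Set ℝ, MeasurableSet N ∧ P.proj N = 0 ∧
      TendstoUniformlyOn (fun n x => S n x) T Filter.atTop (σ \ N)) ∧
    Filter.Tendsto (fun n => P.integralSum σ B (S n)) Filter.atTop (nhds I)

end ProjectionMeasure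

/-! ### The two-channel Hamiltonian and the channel Hamiltonians -/

/-- The operator matrix with diagonal entries `A₁`, `A₂` and bounded off-diagonal entries `B₁₂`,
`B₂₁`, acting in the orthogonal sum of the channel spaces, with domain `D(A₁) ⊕ D(A₂)`. -/
def twoChannelHamiltonian (A₁ : E →ₗ.[ℂ] E) (A₂ : F →ₗ.[ℂ] F) (B₁₂ : F →L[ℂ] E)
    (B₂₁ : E →L[ℂ] F) : WithLp 2 (E × F) →ₗ.[ℂ] WithLp 2 (E × F) where
  domain := (A₁.domain.prod A₂.domain).comap (WithLp.linearEquiv 2 ℂ (E × F)).toLinearMap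
  toFun :=
    { toFun := fun U => WithLp.toLp 2
        (A₁ ⟨U.1.fst, U.2.1⟩ + B₁₂ U.1.snd, B₂₁ U.1.fst + A₂ ⟨U.1.snd, U.2.2⟩)
      map_add' := fun U V => by
        have h₁ := A₁.map_add ⟨U.1.fst, U.2.1⟩ ⟨V.1.fst, V.2.1⟩
        have h₂ := A₂.map_add ⟨U.1.snd, U.2.2⟩ ⟨V.1.snd, V.2.2⟩
        rw [← WithLp.toLp_add]
        congr 1
        refine Prod.ext ?_ ?_
        · calc _ = A₁ (⟨U.1.fst, U.2.1⟩ + ⟨V.1.fst, V.2.1⟩) + B₁₂ (U.1.snd + V.1.snd) := rfl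
            _ = _ := by rw [h₁, map_add]; exact add_add_add_comm _ _ _ _
        · calc _ = B₂₁ (U.1.fst + V.1.fst) + A₂ (⟨U.1.snd, U.2.2⟩ + ⟨V.1.snd, V.2.2⟩) := rfl
            _ = _ := by rw [h₂, map_add]; exact add_add_add_comm _ _ _ _
      map_smul' := fun c U => by
        have h₁ := A₁.map_smul c ⟨U.1.fst, U.2.1⟩
        have h₂ := A₂.map_smul c ⟨U.1.snd, U.2.2⟩
        rw [← WithLp.toLp_smul]
        congr 1
        refine Prod.ext ?_ ?_
        · calc _ = A₁ (c • ⟨U.1.fst, U.2.1⟩) + B₁₂ (c • U.1.snd) := rfl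
            _ = _ := by rw [h₁, map_smul]; exact (smul_add _ _ _).symm
        · calc _ = B₂₁ (c • U.1.fst) + A₂ (c • ⟨U.1.snd, U.2.2⟩) := rfl
            _ = _ := by rw [h₂, map_smul]; exact (smul_add _ _ _).symm }

/-- The channel Hamiltonian `H = A + B Q` with domain `D(A)`. -/
def channelHamiltonian (A : E →ₗ.[ℂ] E) (B : F →L[ℂ] E) (Q : E →L[ℂ] F) : E →ₗ.[ℂ] E where
  domain := A.domain
  toFun := A.toFun + ((B ∘L Q : E →L[ℂ] E) : E →ₗ[ℂ] E).comp A.domain.subtype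

/-- The basic integral equation for `Q = Q_{βα}`, with `Aα`, `Aβ` acting in `E`, `F`:
`Q = ∫_{σ(Aβ)} Eβ(dμ) B_{βα} (Aα + B_{αβ} Q - μ)⁻¹`, where `Eβ` is the spectral measure of `Aβ`.
The equation presupposes that the resolvent exists for all `μ` in the spectrum of `Aβ`. -/
def SolvesBasicEquation (Aα : E →ₗ.[ℂ] E) (Aβ : F →ₗ.[ℂ] F) (Bαβ : F →L[ℂ] E) (Bβα : E →L[ℂ] F)
    (Q : E →L[ℂ] F) : Prop :=
  spectrum Aβ ⊆ resolventSet (channelHamiltonian Aα Bαβ Q) ∧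
    ∃ Eβ : ProjectionMeasure F, Eβ.IsSpectralMeasureOf Aβ ∧
      Eβ.HasIntegral (realSpectrum Aβ) Bβα
        (fun μ => resolvent (channelHamiltonian Aα Bαβ Q) (μ : ℂ)) Q

/-- The symmetric form of the basic equation for `Q = Q_{βα}`, as an equality of operators on
`D(Aα)`: `Q` maps `D(Aα)` into `D(Aβ)` and `Q Aα - Aβ Q + Q B_{αβ} Q = B_{βα}`. -/
def SolvesSymmetricEquation (Aα : E →ₗ.[ℂ] E) (Aβ : F →ₗ.[ℂ] F) (Bαβ : F →L[ℂ] E)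
    (Bβα : E →L[ℂ] F) (Q : E →L[ℂ] F) : Prop :=
  ∀ f : Aα.domain, ∃ h : Q f ∈ Aβ.domain,
    Q (Aα f) - Aβ ⟨Q f, h⟩ + Q (Bαβ (Q f)) = Bβα f

/-- The resolvent estimate `‖(H - μ)⁻¹‖ ≤ C / (1 + |μ|)` for all `μ ∈ σ`, with some `C > 0`. -/
def ResolventEstimate (H : E →ₗ.[ℂ] E) (σ : Set ℂ) : Prop :=
  ∃ C : ℝ, 0 < C ∧ ∀ μ ∈ σ, μ ∈ resolventSet H ∧ ‖resolvent H μ‖ ≤ C / (1 + ‖μ‖)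

/-- The eigenvectors `U = {u₁, u₂}` of `H` whose component in channel 1 is an eigenvector of `H₁`
corresponding to the same eigenvalue. -/
def capturedByFirst (H : WithLp 2 (E × F) →ₗ.[ℂ] WithLp 2 (E × F)) (H₁ : E →ₗ.[ℂ] E) :
    Set (WithLp 2 (E × F)) :=
  {U | ∃ z : ℂ, IsEigenvector H z U ∧ IsEigenvector H₁ z U.fst}

/-- The eigenvectors `U = {u₁, u₂}` of `H` whose component in channel 2 is an eigenvector of `H₂`
corresponding to the same eigenvalue. -/
def capturedBySecond (H : WithLp 2 (E × F) →ₗ.[ℂ] WithLp 2 (E × F)) (H₂ : F →ₗ.[ℂ] F) :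
    Set (WithLp 2 (E × F)) :=
  {U | ∃ z : ℂ, IsEigenvector H z U ∧ IsEigenvector H₂ z U.snd}

end TwoChannel

end

namespace TwoChannel

variable {E F : Type*}
  [NormedAddCommGroup E] [InnerProductSpace ℂ E]
  [NormedAddCommGroup F] [InnerProductSpace ℂ F]

/-! An eigenvalue `z` of `H₁` lies outside the resolvent set of `H₁`, hence outside `σ(A₂)`, so `A₂
- z` is injective. Applied to `u₁`, the symmetric equation gives `(A₂ - z) Q u₁ = -B₂₁ u₁`; the
second row of the eigenvalue equation for `U` says the same of `u₂`, whence `u₂ = Q u₁`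
(`SolvesSymmetricEquation.eq_apply_of_isEigenvector`). Taking adjoints, `-Q*` solves the equation
with the channels swapped (`SolvesSymmetricEquation.neg_adjoint`), so an eigenvector `u₂` of `H₂`
would force `u₁ = -Q* u₂`. Then `‖u₁‖² = -⟨Q u₁, u₂⟩ = -‖u₂‖²`, contradicting `u₁ ≠ 0`. -/

theorem IsEigenvector.notMem_resolventSet {T : E →ₗ.[ℂ] E} {z : ℂ} {u : E}
    (h : IsEigenvector T z u) : z ∉ resolventSet T := by
  rintro ⟨R, -, hR⟩
  obtain ⟨hu, hd, hT⟩ := h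
  have := hR ⟨u, hd⟩
  rw [hT, sub_self, map_zero] at this
  exact hu this.symm

/-- If `u` is an eigenvector of `A₁ + B₁₂ Q` for `z` and `(A₂ - z) v = -B₂₁ u`, then `v = Q u`,
provided that `σ(A₂)` lies in the resolvent set of `A₁ + B₁₂ Q`. -/
theorem SolvesSymmetricEquation.eq_apply_of_isEigenvector {A₁ : E →ₗ.[ℂ] E} {A₂ : F →ₗ.[ℂ] F}
    {B₁₂ : F →L[ℂ] E} {B₂₁ : E →L[ℂ] F} {Q : E →L[ℂ] F}
    (h : SolvesSymmetricEquation A₁ A₂ B₁₂ B₂₁ Q)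
    (hres : spectrum A₂ ⊆ resolventSet (channelHamiltonian A₁ B₁₂ Q)) {z : ℂ} {u : E} {v : F}
    (hu : IsEigenvector (channelHamiltonian A₁ B₁₂ Q) z u) (hv : v ∈ A₂.domain)
    (huv : B₂₁ u + A₂ ⟨v, hv⟩ = z • v) : v = Q u := by
  by_contra hne
  obtain ⟨hd, hz⟩ := hu.2
  obtain ⟨hQ, e⟩ := h ⟨u, hd⟩
  have hz' : A₁ ⟨u, hd⟩ = z • u - B₁₂ (Q u) := eq_sub_of_add_eq hz
  have hA : A₂ ⟨v - Q u, A₂.domain.sub_mem hv hQ⟩ = A₂ ⟨v, hv⟩ - A₂ ⟨Q u, hQ⟩ :=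
    A₂.map_sub ⟨v, hv⟩ ⟨Q u, hQ⟩
  -- It remains to place `z` in `σ(A₂)`: the nonzero difference `v - Q u` is an eigenvector of `A₂`,
  -- since the inhomogeneous terms `-B₂₁ u` cancel.
  refine hu.notMem_resolventSet (hres ?_)
  refine IsEigenvector.notMem_resolventSet (u := v - Q u)
    ⟨sub_ne_zero.mpr hne, A₂.domain.sub_mem hv hQ, ?_⟩
  -- Substituting `A₁ u = z u - B₁₂ Q u` cancels the term quadratic in `Q`.
  rw [hz', map_sub, map_smul] at e
  rw [hA, smul_sub, ← huv, sub_eq_sub_iff_add_eq_add, ← e]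
  abel

variable [CompleteSpace E] [CompleteSpace F]

/-- The symmetric equation passes to `-Q*` with the two channels interchanged. -/
theorem SolvesSymmetricEquation.neg_adjoint {A₁ : E →ₗ.[ℂ] E} {A₂ : F →ₗ.[ℂ] F}
    (hA₁ : IsSelfAdjoint A₁) (hA₂ : IsSelfAdjoint A₂) {B : F →L[ℂ] E} {Q : E →L[ℂ] F}
    (h : SolvesSymmetricEquation A₁ A₂ B (ContinuousLinearMap.adjoint B) Q) :
    SolvesSymmetricEquation A₂ A₁ (ContinuousLinearMap.adjoint B) B
      (-ContinuousLinearMap.adjoint Q) := by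
  intro g
  have hd₁ : Dense (A₁.domain : Set E) := hA₁.dense_domain
  have hsym : A₂.IsFormalAdjoint A₂ := by
    have := A₂.adjoint_isFormalAdjoint hA₂.dense_domain
    rwa [LinearPMap.isSelfAdjoint_def.mp hA₂] at this
  set Q' := ContinuousLinearMap.adjoint Q with hQ'
  set B' := ContinuousLinearMap.adjoint B with hB'
  -- The weak form of the swapped equation: pair the given one with `g` and move every operator
  -- except `A₁` onto `g`.
  have key : ∀ f : A₁.domain,
      inner ℂ (Q' (A₂ g) - Q' (B' (Q' g)) + B g) (f : E) = inner ℂ (Q' (g : F)) (A₁ f) := by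
    intro f
    obtain ⟨hf, e⟩ := h f
    have h1 : inner ℂ (g : F) (A₂ ⟨Q f, hf⟩) = inner ℂ (A₂ g) (Q f) :=
      (hsym g ⟨Q f, hf⟩).symm
    have h2 := congrArg (fun v => inner ℂ (g : F) v) e
    simp only [inner_add_right, inner_sub_right, h1] at h2
    simp only [inner_add_left, inner_sub_left, hQ', hB',
      ContinuousLinearMap.adjoint_inner_left]
    simp only [hB', ContinuousLinearMap.adjoint_inner_right] at h2
    linear_combination -h2
  -- By `key`, `Q' g` lies in the domain of the adjoint of `A₁`. Symmetry alone would not suffice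
  -- here: self-adjointness identifies this domain with that of `A₁`.
  have hmem : Q' (g : F) ∈ A₁.domain := by
    have := A₁.mem_adjoint_domain_of_exists (Q' (g : F)) ⟨_, key⟩
    rwa [LinearPMap.isSelfAdjoint_def.mp hA₁] at this
  have hval : A₁ ⟨Q' (g : F), hmem⟩ = Q' (A₂ g) - Q' (B' (Q' g)) + B g := by
    have hsym₁ : A₁.IsFormalAdjoint A₁ := by
      have := A₁.adjoint_isFormalAdjoint hd₁
      rwa [LinearPMap.isSelfAdjoint_def.mp hA₁] at this
    refine hd₁.eq_of_inner_left (𝕜 := ℂ) fun f hf => ?_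
    rw [key ⟨f, hf⟩]
    exact hsym₁ ⟨_, hmem⟩ ⟨f, hf⟩
  have hneg : (-Q') (g : F) ∈ A₁.domain := A₁.domain.neg_mem hmem
  refine ⟨hneg, ?_⟩
  have hv : A₁ ⟨(-Q') (g : F), hneg⟩ = -A₁ ⟨Q' (g : F), hmem⟩ := A₁.map_neg ⟨_, hmem⟩
  rw [hv, hval]
  -- Passing from `Q'` to `-Q'` flips the linear terms but not the quadratic one, which yields the
  -- required signs.
  simp only [neg_apply, map_neg]
  abel

/-- An eigenvector of the two-channel Hamiltonian is not captured by both channel Hamiltonians. -/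
theorem not_isEigenvector_snd_of_isEigenvector_fst {A₁ : E →ₗ.[ℂ] E} {A₂ : F →ₗ.[ℂ] F}
    (hA₁ : IsSelfAdjoint A₁) (hA₂ : IsSelfAdjoint A₂) {B : F →L[ℂ] E} {Q : E →L[ℂ] F}
    (h : SolvesSymmetricEquation A₁ A₂ B (ContinuousLinearMap.adjoint B) Q)
    (hres₁ : spectrum A₂ ⊆ resolventSet (channelHamiltonian A₁ B Q))
    (hres₂ : spectrum A₁ ⊆ resolventSet (channelHamiltonian A₂ (ContinuousLinearMap.adjoint B)
      (-ContinuousLinearMap.adjoint Q))) {z : ℂ} {U : WithLp 2 (E × F)}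
    (hU : IsEigenvector (twoChannelHamiltonian A₁ A₂ B (ContinuousLinearMap.adjoint B)) z U)
    (hu₁ : IsEigenvector (channelHamiltonian A₁ B Q) z U.fst) :
    ¬ IsEigenvector (channelHamiltonian A₂ (ContinuousLinearMap.adjoint B)
      (-ContinuousLinearMap.adjoint Q)) z U.snd := by
  intro hu₂
  obtain ⟨-, hd, hz⟩ := hU
  have hz₁ : A₁ ⟨U.fst, hd.1⟩ + B U.snd = z • U.fst := congrArg WithLp.fst hz
  have hz₂ : ContinuousLinearMap.adjoint B U.fst + A₂ ⟨U.snd, hd.2⟩ = z • U.snd :=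
    congrArg WithLp.snd hz
  have h₂ : U.snd = Q U.fst := h.eq_apply_of_isEigenvector hres₁ hu₁ hd.2 hz₂
  have h₁ : U.fst = (-ContinuousLinearMap.adjoint Q) U.snd :=
    (h.neg_adjoint hA₁ hA₂).eq_apply_of_isEigenvector hres₂ hu₂ hd.1
      ((add_comm _ _).trans hz₁)
  have hle : inner ℂ U.fst U.fst = -inner ℂ U.snd U.snd :=
    calc inner ℂ U.fst U.fst = inner ℂ U.fst ((-ContinuousLinearMap.adjoint Q) U.snd) := by rw [← h₁]
      _ = -inner ℂ (Q U.fst) U.snd := by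
        rw [neg_apply, inner_neg_right,
          ContinuousLinearMap.adjoint_inner_right]
      _ = _ := by rw [← h₂]
  have hle' : ‖U.fst‖ ^ 2 = -‖U.snd‖ ^ 2 := by
    rw [inner_self_eq_norm_sq_to_K, inner_self_eq_norm_sq_to_K] at hle
    exact_mod_cast hle
  exact hu₁.1 (norm_eq_zero.mp (by nlinarith [sq_nonneg ‖U.fst‖, sq_nonneg ‖U.snd‖]))

end TwoChannel

theorem theorem3
    {E₁ : Type*} [NormedAddCommGroup E₁] [InnerProductSpace ℂ E₁] [CompleteSpace E₁]
    {E₂ : Type*} [NormedAddCommGroup E₂] [InnerProductSpace ℂ E₂] [CompleteSpace E₂]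
    (A₁ : E₁ →ₗ.[ℂ] E₁) (A₂ : E₂ →ₗ.[ℂ] E₂)
    (hA₁ : IsSelfAdjoint A₁) (hA₂ : IsSelfAdjoint A₂)
    (hdist : Metric.AreSeparated (TwoChannel.spectrum A₁) (TwoChannel.spectrum A₂))
    (B₁₂ : E₂ →L[ℂ] E₁) (B₂₁ : E₁ →L[ℂ] E₂) (hB : B₂₁ = ContinuousLinearMap.adjoint B₁₂)
    (hB₂ : TwoChannel.IsHilbertSchmidt B₁₂)
    (Q₂₁ : E₁ →L[ℂ] E₂) (Q₁₂ : E₂ →L[ℂ] E₁) (hQ : Q₁₂ = -ContinuousLinearMap.adjoint Q₂₁)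
    (hQbasic : TwoChannel.SolvesBasicEquation A₁ A₂ B₁₂ B₂₁ Q₂₁)
    (hQsym : TwoChannel.SolvesSymmetricEquation A₁ A₂ B₁₂ B₂₁ Q₂₁)
    (H : WithLp 2 (E₁ × E₂) →ₗ.[ℂ] WithLp 2 (E₁ × E₂))
    (hH : H = TwoChannel.twoChannelHamiltonian A₁ A₂ B₁₂ B₂₁)
    (H₁ : E₁ →ₗ.[ℂ] E₁) (hH₁ : H₁ = TwoChannel.channelHamiltonian A₁ B₁₂ Q₂₁)
    (H₂ : E₂ →ₗ.[ℂ] E₂) (hH₂ : H₂ = TwoChannel.channelHamiltonian A₂ B₂₁ Q₁₂)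
    (hres₁ : TwoChannel.ResolventEstimate H₁ (TwoChannel.spectrum A₂))
    (hres₂ : TwoChannel.ResolventEstimate H₂ (TwoChannel.spectrum A₁)) :
    (∀ (z : ℂ) (U : WithLp 2 (E₁ × E₂)), TwoChannel.IsEigenvector H z U →
      TwoChannel.IsEigenvector H₁ z U.fst → ¬ TwoChannel.IsEigenvector H₂ z U.snd) ∧
    (∀ (z : ℂ) (U : WithLp 2 (E₁ × E₂)), TwoChannel.IsEigenvector H z U →
      TwoChannel.IsEigenvector H₂ z U.snd → ¬ TwoChannel.IsEigenvector H₁ z U.fst) ∧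
    Disjoint (TwoChannel.capturedByFirst H H₁) (TwoChannel.capturedBySecond H H₂) := by
  subst hB hQ hH hH₁ hH₂
  have main : ∀ (z : ℂ) (U : WithLp 2 (E₁ × E₂)),
      TwoChannel.IsEigenvector _ z U → TwoChannel.IsEigenvector _ z U.fst →
        ¬ TwoChannel.IsEigenvector _ z U.snd := fun _ _ =>
    TwoChannel.not_isEigenvector_snd_of_isEigenvector_fst hA₁ hA₂ hQsym
      (fun μ hμ => (hres₁.choose_spec.2 μ hμ).1) (fun μ hμ => (hres₂.choose_spec.2 μ hμ).1)
  refine ⟨main, fun z U hU h₂ h₁ => main z U hU h₁ h₂, ?_⟩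
  rw [Set.disjoint_left]
  rintro U ⟨z, hU, h₁⟩ ⟨w, hU', h₂⟩
  -- The two memberships come with separate eigenvalues, but `U ≠ 0` determines its eigenvalue under
  -- the full Hamiltonian.
  have hzw : z = w := by
    obtain ⟨hne, hd, hz⟩ := hU
    exact smul_left_injective ℂ hne (hz.symm.trans hU'.2.choose_spec)
  exact main z U hU h₁ (hzw ▸ h₂)
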